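/- Let $q$ be a complex number with $|q|<1$. Write $(a;q)_\infty=\prod_{k\ge 0}(1-aq^k)$, $(a;q)_n=\prod_{k=0}^{n-1}(1-aq^k)$ for integers $n\ge 0$, and $(a,b;q)_\infty=(a;q)_\infty(b;q)_\infty$ (and likewise with $q$ replaced by $q^2$ or $q^{10}$). Then both double series below converge absolutely, and $$\sum_{i,j\ge 0}\frac{q^{2ij+i+j}}{(q;q)_{2i}(q;q)_{2j}}=\frac{1}{(q;q^2)_\infty^2\,(q^2,q^8;q^{10})_\infty},$$ $$\sum_{i,j\ge 0}\frac{q^{2ij+i+3j}}{(q;q)_{2i+1}(q;q)_{2j}}=\frac{1}{(q;q^2)_\infty^2\,(q^4,q^6;q^{10})_\infty}.$$ -/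

import Mathlib

/-- The finite `q`-shifted factorial `(a; q)_n = ∏_{k=0}^{n-1} (1 - a q^k)`, for `n ≥ 0`. -/
noncomputable def qPoch (a q : ℂ) (n : ℕ) : ℂ :=
  ∏ k ∈ Finset.range n, (1 - a * q ^ k)

/-- The infinite `q`-shifted factorial `(a; q)_∞ = ∏_{k=0}^∞ (1 - a q^k)`, used for `|q| < 1`. -/
noncomputable def qPochInf (a q : ℂ) : ℂ :=
  ∏' k : ℕ, (1 - a * q ^ k)

/-- The infinite product defining `(a; q)_∞` converges for `|q| < 1`. -/
theorem qPochInf_multipliable (a : ℂ) {q : ℂ} (hq : ‖q‖ < 1) :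
    Multipliable fun k : ℕ => 1 - a * q ^ k := by
  have h : Summable fun k : ℕ => ‖-(a * q ^ k)‖ := by
    simpa [norm_mul, norm_pow] using
      (summable_geometric_of_lt_one (norm_nonneg q) hq).mul_left ‖a‖
  simpa [sub_eq_add_neg] using multipliable_one_add_of_summable h

/-- `(a; q)_∞ ≠ 0` when `|q| < 1` and no factor vanishes. -/
theorem qPochInf_ne_zero (a : ℂ) {q : ℂ} (hq : ‖q‖ < 1) (h0 : ∀ k : ℕ, 1 - a * q ^ k ≠ 0) :
    qPochInf a q ≠ 0 := by
  have h : Summable fun k : ℕ => ‖-(a * q ^ k)‖ := by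
    simpa [norm_mul, norm_pow] using
      (summable_geometric_of_lt_one (norm_nonneg q) hq).mul_left ‖a‖
  simpa [qPochInf, sub_eq_add_neg] using
    tprod_one_add_ne_zero_of_summable (f := fun k : ℕ => -(a * q ^ k))
      (by simpa [sub_eq_add_neg] using h0) h

/-- `(a; q)_n = (a; q)_∞ / (a q^n; q)_∞` whenever the denominator is nonzero. -/
theorem qPoch_eq_div (a : ℂ) {q : ℂ} (hq : ‖q‖ < 1) (n : ℕ)
    (hn : qPochInf (a * q ^ n) q ≠ 0) :
    qPoch a q n = qPochInf a q / qPochInf (a * q ^ n) q := by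
  have hs : (fun k : ℕ => 1 - a * q ^ (k + n)) = fun k : ℕ => 1 - a * q ^ n * q ^ k := by
    funext k
    ring
  have hm : Multipliable fun k : ℕ => 1 - a * q ^ (k + n) := by
    rw [hs]
    exact qPochInf_multipliable _ hq
  have h := Multipliable.prod_mul_tprod_nat_mul' (f := fun k : ℕ => 1 - a * q ^ k) hm
  rw [hs] at h
  rw [eq_div_iff hn]
  exact h

/-!
Euler's two expansions `∑ z^n / (q; q)_n = 1 / (z; q)_∞` and
`∑ z^n q^(n(n-1)/2) / (q; q)_n = (-z; q)_∞` differ by the factor `(z; q)_∞ (-z; q)_∞ = (z²; q²)_∞`,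
which is even in `z`, so their even parts and their odd parts differ by the same factor. For fixed
`j`, taking `z² = q^(2j+1)` transforms the sum over `i`; since
`(q; q)_{2j} (q^(2j+1); q²)_∞ = (q; q²)_∞ (q²; q²)_j`, the sum over `j` then becomes an instance of
Euler's first expansion with base `q²`. What remains is `1 / (q; q²)_∞²` times one of the two
Rogers–Ramanujan series with base `q²`.

The Rogers–Ramanujan identities follow by comparing `∑ a^n q^(n(n-1)) / (q; q)_n` with a
Rogers–Selberg function: after division by `(a; q)_∞` the latter satisfies the same recurrence
`F(a) = F(aq) + a F(aq²)`, and both tend to `1` as `a → 0` along `a q^n`. At `a = q` the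
Rogers–Selberg function is a theta series, which the Jacobi triple product evaluates.
-/

open Filter Topology

section QPochhammer

variable {a q : ℂ}

theorem norm_pow_succ_lt_one (hq : ‖q‖ < 1) (n : ℕ) : ‖q ^ (n + 1)‖ < 1 := by
  rw [norm_pow]
  exact pow_lt_one₀ (norm_nonneg q) hq n.succ_ne_zero

theorem norm_mul_pow_le (hq : ‖q‖ < 1) (a : ℂ) (n : ℕ) : ‖a * q ^ n‖ ≤ ‖a‖ := by
  rw [norm_mul, norm_pow]
  exact mul_le_of_le_one_right (norm_nonneg a) (pow_le_one₀ (norm_nonneg q) hq.le)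

theorem tendsto_mul_pow_nhds_zero (hq : ‖q‖ < 1) (a : ℂ) :
    Tendsto (fun n : ℕ => a * q ^ n) atTop (𝓝 0) := by
  simpa only [mul_zero] using (tendsto_pow_atTop_nhds_zero_of_norm_lt_one hq).const_mul a

theorem one_sub_ne_zero_of_norm_lt_one (ha : ‖a‖ < 1) : 1 - a ≠ 0 := by
  rintro h
  rw [← sub_eq_zero.mp h, norm_one] at ha
  exact lt_irrefl 1 ha

theorem norm_one_sub_le_two (ha : ‖a‖ ≤ 1) : ‖1 - a‖ ≤ 2 := by
  have h := norm_sub_le 1 a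
  rw [norm_one] at h
  linarith

theorem qPoch_ne_zero (hq : ‖q‖ < 1) (ha : ‖a‖ < 1) (n : ℕ) : qPoch a q n ≠ 0 :=
  Finset.prod_ne_zero_iff.mpr fun k _ =>
    one_sub_ne_zero_of_norm_lt_one ((norm_mul_pow_le hq a k).trans_lt ha)

theorem qPochInf_ne_zero_of_norm_lt_one (hq : ‖q‖ < 1) (ha : ‖a‖ < 1) : qPochInf a q ≠ 0 :=
  qPochInf_ne_zero a hq fun k =>
    one_sub_ne_zero_of_norm_lt_one ((norm_mul_pow_le hq a k).trans_lt ha)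

theorem qPoch_zero (a q : ℂ) : qPoch a q 0 = 1 :=
  Finset.prod_range_zero _

theorem qPoch_add (a q : ℂ) (m n : ℕ) :
    qPoch a q (m + n) = qPoch a q m * qPoch (a * q ^ m) q n := by
  simp only [qPoch, Finset.prod_range_add, pow_add, mul_assoc]

theorem qPoch_one (a q : ℂ) : qPoch a q 1 = 1 - a := by
  rw [qPoch, Finset.prod_range_one, pow_zero, mul_one]

theorem qPoch_succ (a q : ℂ) (n : ℕ) : qPoch a q (n + 1) = qPoch a q n * (1 - a * q ^ n) := by
  rw [qPoch_add, qPoch_one]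

theorem qPoch_succ' (a q : ℂ) (n : ℕ) : qPoch a q (n + 1) = (1 - a) * qPoch (a * q) q n := by
  rw [add_comm, qPoch_add, qPoch_one, pow_one]

theorem qPoch_self_succ (q : ℂ) (n : ℕ) :
    qPoch q q (n + 1) = qPoch q q n * (1 - q ^ (n + 1)) := by
  rw [qPoch_succ, pow_succ']

theorem qPoch_mul_index (a q : ℂ) (m n : ℕ) :
    qPoch a q (m * n) = ∏ i ∈ Finset.range m, qPoch (a * q ^ i) (q ^ m) n := by
  induction n with
  | zero => simp only [mul_zero, qPoch_zero, Finset.prod_const_one]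
  | succ n ih =>
    simp only [mul_add_one, qPoch_add _ _ _ m, qPoch_succ, Finset.prod_mul_distrib, ← ih]
    congr 1
    exact Finset.prod_congr rfl fun k _ => by ring

theorem tendsto_qPoch (a : ℂ) (hq : ‖q‖ < 1) :
    Tendsto (qPoch a q) atTop (𝓝 (qPochInf a q)) :=
  (qPochInf_multipliable a hq).hasProd.tendsto_prod_nat

theorem qPoch_mul_qPochInf (a : ℂ) (hq : ‖q‖ < 1) (n : ℕ) :
    qPoch a q n * qPochInf (a * q ^ n) q = qPochInf a q := by
  have h := (tendsto_qPoch a hq).comp (tendsto_add_atTop_nat n)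
  simp only [Function.comp_def, add_comm _ n, qPoch_add] at h
  exact tendsto_nhds_unique ((tendsto_qPoch _ hq).const_mul _) h

theorem qPochInf_eq_one_sub_mul (a : ℂ) (hq : ‖q‖ < 1) :
    qPochInf a q = (1 - a) * qPochInf (a * q) q := by
  rw [← qPoch_mul_qPochInf a hq 1, qPoch_one, pow_one]

theorem qPochInf_mul_neg (a : ℂ) (hq : ‖q‖ < 1) :
    qPochInf a q * qPochInf (-a) q = qPochInf (a ^ 2) (q ^ 2) := by
  rw [qPochInf, qPochInf, ← (qPochInf_multipliable a hq).tprod_mul (qPochInf_multipliable (-a) hq)]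
  exact tprod_congr fun k => by ring

theorem qPochInf_eq_prod (a : ℂ) (hq : ‖q‖ < 1) (m : ℕ) :
    qPochInf a q = ∏ i ∈ Finset.range (m + 1), qPochInf (a * q ^ i) (q ^ (m + 1)) := by
  have h := (tendsto_qPoch a hq).comp (tendsto_id.const_mul_atTop' m.succ_pos)
  simp only [Function.comp_def, id, qPoch_mul_index] at h
  exact tendsto_nhds_unique h
    (tendsto_finsetProd _ fun i _ => tendsto_qPoch _ (norm_pow_succ_lt_one hq m))

theorem tendsto_qPochInf_mul_pow (hq : ‖q‖ < 1) (ha : ‖a‖ < 1) :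
    Tendsto (fun n => qPochInf (a * q ^ n) q) atTop (𝓝 1) := by
  have h0 := qPochInf_ne_zero_of_norm_lt_one hq ha
  have h := (tendsto_const_nhds (x := qPochInf a q)).div (tendsto_qPoch a hq) h0
  rw [div_self h0] at h
  refine h.congr fun n => ?_
  rw [Pi.div_apply, ← qPoch_mul_qPochInf a hq n, mul_div_cancel_left₀ _ (qPoch_ne_zero hq ha n)]

theorem exists_norm_qPoch_inv_le (hq : ‖q‖ < 1) (ha : ‖a‖ < 1) :
    ∃ C, ∀ n, ‖(qPoch a q n)⁻¹‖ ≤ C := by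
  obtain ⟨C, hC⟩ := (Metric.isBounded_range_of_tendsto _
    ((tendsto_qPoch a hq).inv₀ (qPochInf_ne_zero_of_norm_lt_one hq ha))).exists_norm_le
  exact ⟨C, fun n => hC _ ⟨n, rfl⟩⟩

theorem exists_forall_norm_qPoch_le (hq : ‖q‖ < 1) (r : ℝ) :
    ∃ C, ∀ a : ℂ, ‖a‖ ≤ r → ∀ n, ‖qPoch a q n‖ ≤ C := by
  have hs := (summable_geometric_of_lt_one (norm_nonneg q) hq).mul_left r
  refine ⟨Real.exp (∑' k, r * ‖q‖ ^ k), fun a ha n => ?_⟩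
  have hr : 0 ≤ r := (norm_nonneg a).trans ha
  calc ‖qPoch a q n‖ ≤ ∏ k ∈ Finset.range n, Real.exp (r * ‖q‖ ^ k) := by
        rw [qPoch, norm_prod]
        refine Finset.prod_le_prod (fun _ _ => norm_nonneg _) fun k _ => ?_
        calc ‖1 - a * q ^ k‖ ≤ 1 + ‖a‖ * ‖q‖ ^ k := by
              simpa only [norm_one, norm_mul, norm_pow] using norm_sub_le 1 (a * q ^ k)
          _ ≤ r * ‖q‖ ^ k + 1 := by rw [add_comm]; gcongr
          _ ≤ Real.exp (r * ‖q‖ ^ k) := Real.add_one_le_exp _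
    _ = Real.exp (∑ k ∈ Finset.range n, r * ‖q‖ ^ k) := (Real.exp_sum _ _).symm
    _ ≤ Real.exp (∑' k, r * ‖q‖ ^ k) :=
        Real.exp_le_exp.mpr (hs.sum_le_tsum _ fun k _ => by positivity)

end QPochhammer

theorem succ_choose_two (n : ℕ) : (n + 1).choose 2 = n + n.choose 2 := by
  rw [Nat.choose_succ_succ' n 1, Nat.choose_one_right]

section QExponential

/-- The general term of `qExpSeries`. -/
noncomputable def qExpTerm (α : ℕ) (q z : ℂ) (n : ℕ) : ℂ :=
  z ^ n * q ^ (α * n.choose 2) / qPoch q q n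

/-- The one-parameter `q`-exponential family: `α = 0, 1` give Euler's two `q`-exponentials, and
`α = 2` the Rogers–Ramanujan series. -/
noncomputable def qExpSeries (α : ℕ) (q z : ℂ) : ℂ :=
  ∑' n, qExpTerm α q z n

variable {α : ℕ} {q z : ℂ}

theorem qExpTerm_zero (α : ℕ) (q z : ℂ) : qExpTerm α q z 0 = 1 := by
  simp [qExpTerm, qPoch_zero]

theorem qExpTerm_succ_mul (hq : ‖q‖ < 1) (α : ℕ) (z : ℂ) (n : ℕ) :
    qExpTerm α q z (n + 1) * (1 - q ^ (n + 1)) = z * q ^ (α * n) * qExpTerm α q z n := by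
  have h0 := qPoch_ne_zero hq hq n
  have h1 := one_sub_ne_zero_of_norm_lt_one (norm_pow_succ_lt_one hq n)
  rw [qExpTerm, qExpTerm, qPoch_self_succ, succ_choose_two]
  field_simp
  ring

theorem qExpTerm_mul (α : ℕ) (q z w : ℂ) (n : ℕ) :
    qExpTerm α q (z * w) n = qExpTerm α q z n * w ^ n := by
  rw [qExpTerm, qExpTerm, mul_pow]
  ring

theorem norm_qExpTerm_le {w : ℂ} (h : ‖z‖ ≤ ‖w‖) (α : ℕ) (q : ℂ) (n : ℕ) :
    ‖qExpTerm α q z n‖ ≤ ‖qExpTerm α q w n‖ := by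
  simp only [qExpTerm, norm_div, norm_mul, norm_pow]
  gcongr

theorem summable_pow_mul_pow_choose (hq : ‖q‖ < 1) (hz : α = 0 → ‖z‖ < 1) :
    Summable fun n : ℕ => z ^ n * q ^ (α * n.choose 2) := by
  obtain ⟨r, hr, hev⟩ : ∃ r < 1, ∀ᶠ n : ℕ in atTop, ‖z * (q ^ α) ^ n‖ ≤ r := by
    cases α with
    | zero => exact ⟨‖z‖, hz rfl, by simp⟩
    | succ α =>
      have h := (tendsto_mul_pow_nhds_zero (norm_pow_succ_lt_one hq α) z).norm
      rw [norm_zero] at h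
      exact ⟨1 / 2, by norm_num, h.eventually_le_const (by norm_num)⟩
  refine summable_of_ratio_norm_eventually_le hr (hev.mono fun n hn => ?_)
  calc ‖z ^ (n + 1) * q ^ (α * (n + 1).choose 2)‖
      = ‖z * (q ^ α) ^ n‖ * ‖z ^ n * q ^ (α * n.choose 2)‖ := by
        rw [← norm_mul, succ_choose_two]
        ring_nf
    _ ≤ r * ‖z ^ n * q ^ (α * n.choose 2)‖ := by gcongr

theorem summable_qExpTerm (hq : ‖q‖ < 1) (hz : α = 0 → ‖z‖ < 1) : Summable (qExpTerm α q z) := by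
  obtain ⟨C, hC⟩ := exists_norm_qPoch_inv_le hq hq
  refine .of_norm_bounded ((summable_pow_mul_pow_choose hq hz).norm.mul_right C) fun n => ?_
  rw [qExpTerm, div_eq_mul_inv, norm_mul]
  gcongr
  exact hC n

theorem hasSum_qExpSeries (hq : ‖q‖ < 1) (hz : α = 0 → ‖z‖ < 1) :
    HasSum (qExpTerm α q z) (qExpSeries α q z) :=
  (summable_qExpTerm hq hz).hasSum

theorem qExpSeries_sub (hq : ‖q‖ < 1) (hz : α = 0 → ‖z‖ < 1) :
    qExpSeries α q z - qExpSeries α q (z * q) = z * qExpSeries α q (z * q ^ α) := by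
  have hzq : α = 0 → ‖z * q‖ < 1 := fun h => by
    simpa only [pow_one] using (norm_mul_pow_le hq z 1).trans_lt (hz h)
  have hzα : α = 0 → ‖z * q ^ α‖ < 1 := fun h => (norm_mul_pow_le hq z α).trans_lt (hz h)
  have hsub := (hasSum_qExpSeries hq hz).sub (hasSum_qExpSeries hq hzq)
  rw [← hasSum_nat_add_iff' 1, Finset.sum_range_one, qExpTerm_zero, qExpTerm_zero, sub_self,
    sub_zero] at hsub
  refine hsub.unique (((hasSum_qExpSeries hq hzα).mul_left z).congr_fun fun n => ?_)
  calc qExpTerm α q z (n + 1) - qExpTerm α q (z * q) (n + 1)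
      = qExpTerm α q z (n + 1) * (1 - q ^ (n + 1)) := by rw [qExpTerm_mul]; ring
    _ = z * qExpTerm α q (z * q ^ α) n := by
      rw [qExpTerm_succ_mul hq, qExpTerm_mul, ← pow_mul]
      ring

theorem tendsto_qExpSeries (hq : ‖q‖ < 1) (hz : α = 0 → ‖z‖ < 1) :
    Tendsto (fun n : ℕ => qExpSeries α q (z * q ^ n)) atTop (𝓝 1) := by
  have h0 : ∑' k : ℕ, (if k = 0 then (1 : ℂ) else 0) = 1 := tsum_ite_eq 0 _
  rw [← h0]
  refine tendsto_tsum_of_dominated_convergence (summable_qExpTerm hq hz).norm (fun k => ?_)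
    (Eventually.of_forall fun n k => norm_qExpTerm_le (norm_mul_pow_le hq z n) α q k)
  rcases eq_or_ne k 0 with rfl | hk
  · simp [qExpTerm_zero]
  · have h := ((tendsto_pow_atTop_nhds_zero_of_norm_lt_one hq).pow k).const_mul (qExpTerm α q z k)
    simpa only [qExpTerm_mul, if_neg hk, zero_pow hk, mul_zero] using h

theorem qExpSeries_zero (hq : ‖q‖ < 1) (hz : ‖z‖ < 1) : qExpSeries 0 q z = (qPochInf z q)⁻¹ := by
  have iterate (n : ℕ) : qExpSeries 0 q z * qPoch z q n = qExpSeries 0 q (z * q ^ n) := by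
    induction n with
    | zero => rw [qPoch_zero, pow_zero, mul_one, mul_one]
    | succ n ih =>
      have step := qExpSeries_sub (α := 0) hq fun _ => (norm_mul_pow_le hq z n).trans_lt hz
      rw [pow_zero, mul_one, mul_assoc z, ← pow_succ] at step
      rw [qPoch_succ]
      linear_combination (1 - z * q ^ n) * ih + step
  have h := (tendsto_qPoch z hq).const_mul (qExpSeries 0 q z)
  simp only [iterate] at h
  exact eq_inv_of_mul_eq_one_left (tendsto_nhds_unique h (tendsto_qExpSeries hq fun _ => hz))

theorem qExpSeries_one (hq : ‖q‖ < 1) (z : ℂ) : qExpSeries 1 q z = qPochInf (-z) q := by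
  have iterate (n : ℕ) : qPoch (-z) q n * qExpSeries 1 q (z * q ^ n) = qExpSeries 1 q z := by
    induction n with
    | zero => rw [qPoch_zero, pow_zero, mul_one, one_mul]
    | succ n ih =>
      have step := qExpSeries_sub (α := 1) (z := z * q ^ n) hq (absurd · one_ne_zero)
      rw [pow_one, mul_assoc z, ← pow_succ] at step
      rw [qPoch_succ]
      linear_combination ih - qPoch (-z) q n * step
  have h := (tendsto_qPoch (-z) hq).mul
    (tendsto_qExpSeries (α := 1) (z := z) hq (absurd · one_ne_zero))
  simp only [iterate, mul_one] at h
  exact tendsto_nhds_unique tendsto_const_nhds h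

end QExponential

section JacobiTripleProduct

/-- The general term `(-1)^n a^(n(n+1)/2) b^(n(n-1)/2)`, `n ∈ ℤ`, of Ramanujan's theta function
`f(-a, -b)`, written so that `a` and `b` may vanish. -/
def thetaTerm (a b : ℂ) : ℤ → ℂ
  | (k : ℕ) => (-a) ^ k * (a * b) ^ k.choose 2
  | Int.negSucc k => (-b) ^ (k + 1) * (a * b) ^ (k + 1).choose 2

/-- The reciprocal `1 / (q; q)_m` for `m ∈ ℤ`, which vanishes for `m < 0`. -/
noncomputable def qPochSelfInv (q : ℂ) : ℤ → ℂ
  | (m : ℕ) => (qPoch q q m)⁻¹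
  | Int.negSucc _ => 0

variable {a b q : ℂ}

theorem thetaTerm_natCast (a b : ℂ) (k : ℕ) :
    thetaTerm a b k = (-a) ^ k * (a * b) ^ k.choose 2 :=
  rfl

theorem thetaTerm_neg_natCast (a b : ℂ) (k : ℕ) :
    thetaTerm a b (-k) = (-b) ^ k * (a * b) ^ k.choose 2 := by
  cases k with
  | zero => simp [thetaTerm]
  | succ k => rfl

theorem mul_pow_mul_thetaTerm (a b : ℂ) (j n : ℕ) :
    b * (a * b) ^ n * thetaTerm a b (j - n) = -((a * b) ^ j * thetaTerm a b (j - n - 1)) := by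
  rcases Nat.lt_or_ge n j with h | h
  · obtain ⟨d, rfl⟩ := Nat.exists_eq_add_of_lt h
    have h1 : ((n + d + 1 : ℕ) - n : ℤ) = (d + 1 : ℕ) := by push_cast; ring
    have h2 : ((d + 1 : ℕ) - 1 : ℤ) = d := by push_cast; ring
    rw [h1, h2, thetaTerm_natCast, thetaTerm_natCast, succ_choose_two]
    ring
  · obtain ⟨d, rfl⟩ := Nat.exists_eq_add_of_le h
    have h1 : (j - (j + d : ℕ) : ℤ) = -d := by push_cast; ring
    have h2 : (-d - 1 : ℤ) = -(d + 1 : ℕ) := by push_cast; ring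
    rw [h1, h2, thetaTerm_neg_natCast, thetaTerm_neg_natCast, succ_choose_two]
    ring

theorem summable_thetaTerm (hab : ‖a * b‖ < 1) : Summable (thetaTerm a b) := by
  have hs (c : ℂ) : Summable fun k : ℕ => (-c) ^ k * (a * b) ^ k.choose 2 := by
    simpa only [one_mul] using
      summable_pow_mul_pow_choose (α := 1) (z := -c) hab (absurd · one_ne_zero)
  refine Summable.of_nat_of_neg ((hs a).congr fun k => ?_) ((hs b).congr fun k => ?_)
  · exact (thetaTerm_natCast a b k).symm
  · exact (thetaTerm_neg_natCast a b k).symm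

theorem hasSum_thetaTerm_div_qPoch (hab : ‖a * b‖ < 1) (n : ℕ) :
    HasSum (fun j : ℕ => thetaTerm a b (j - n) / qPoch (a * b) (a * b) j)
      (qPoch b (a * b) n * qPochInf a (a * b)) := by
  induction n with
  | zero =>
    have euler := hasSum_qExpSeries (α := 1) (z := -a) hab (absurd · one_ne_zero)
    rw [qExpSeries_one hab, neg_neg] at euler
    rw [qPoch_zero, one_mul]
    refine euler.congr_fun fun j => ?_
    rw [Nat.cast_zero, sub_zero, thetaTerm_natCast, qExpTerm, one_mul]
  | succ n ih =>
    set S := qPoch b (a * b) n * qPochInf a (a * b)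
    set f : ℕ → ℂ := fun j => thetaTerm a b (j - n - 1) / qPoch (a * b) (a * b) j
    have shifted : HasSum (fun j => (1 - (a * b) ^ j) * f j) S := by
      rw [← hasSum_nat_add_iff' 1, Finset.sum_range_one, pow_zero, sub_self, zero_mul, sub_zero]
      refine ih.congr_fun fun j => ?_
      have h0 := qPoch_ne_zero hab hab j
      have h1 := one_sub_ne_zero_of_norm_lt_one (norm_pow_succ_lt_one hab j)
      have hj : ((j + 1 : ℕ) - n - 1 : ℤ) = j - n := by push_cast; ring
      simp only [f]
      rw [hj, qPoch_self_succ]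
      field_simp
    have weighted : HasSum (fun j => (a * b) ^ j * f j) (-(b * (a * b) ^ n) * S) := by
      refine (ih.mul_left _).congr_fun fun j => ?_
      simp only [f]
      linear_combination mul_pow_mul_thetaTerm a b j n / qPoch (a * b) (a * b) j
    have hS : qPoch b (a * b) (n + 1) * qPochInf a (a * b) = S + -(b * (a * b) ^ n) * S := by
      rw [qPoch_succ]
      ring
    rw [hS]
    refine (shifted.add weighted).congr_fun fun j => ?_
    simp only [f]
    push_cast
    rw [← sub_sub]
    ring

theorem hasSum_thetaTerm_mul_qPochSelfInv (hab : ‖a * b‖ < 1) (n : ℕ) :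
    HasSum (fun k => thetaTerm a b k * qPochSelfInv (a * b) (k + n))
      (qPoch b (a * b) n * qPochInf a (a * b)) := by
  have hinj : Function.Injective fun j : ℕ => (j - n : ℤ) := fun i j h => by simpa using h
  refine (hinj.hasSum_iff fun k hk => ?_).mp
    ((hasSum_thetaTerm_div_qPoch hab n).congr_fun fun j => ?_)
  · rcases hm : k + n with m | m
    · exact absurd ⟨m, (eq_sub_iff_add_eq.mpr hm).symm⟩ hk
    · rw [qPochSelfInv, mul_zero]
  · rw [Function.comp_apply, sub_add_cancel, div_eq_mul_inv]
    rfl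

theorem exists_norm_qPochSelfInv_le (hq : ‖q‖ < 1) : ∃ C, ∀ m, ‖qPochSelfInv q m‖ ≤ C := by
  obtain ⟨C, hC⟩ := exists_norm_qPoch_inv_le hq hq
  refine ⟨C, fun m => ?_⟩
  cases m with
  | ofNat m => exact hC m
  | negSucc m =>
    rw [qPochSelfInv, norm_zero]
    exact (norm_nonneg _).trans (hC 0)

theorem tendsto_qPochSelfInv (hq : ‖q‖ < 1) (k : ℤ) :
    Tendsto (fun n : ℕ => qPochSelfInv q (k + n)) atTop (𝓝 (qPochInf q q)⁻¹) := by
  obtain ⟨m, hm⟩ := Int.eq_ofNat_of_zero_le (show 0 ≤ k + k.natAbs by omega)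
  rw [← tendsto_add_atTop_iff_nat k.natAbs]
  have h := ((tendsto_qPoch q hq).inv₀ (qPochInf_ne_zero_of_norm_lt_one hq hq)).comp
    (tendsto_add_atTop_nat m)
  refine h.congr fun n => ?_
  have hn : k + (n + k.natAbs : ℕ) = (n + m : ℕ) := by omega
  rw [hn]
  rfl

theorem hasSum_jacobi_triple_product (hab : ‖a * b‖ < 1) :
    HasSum (thetaTerm a b)
      (qPochInf (a * b) (a * b) * (qPochInf a (a * b) * qPochInf b (a * b))) := by
  obtain ⟨C, hC⟩ := exists_norm_qPochSelfInv_le hab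
  have h0 := qPochInf_ne_zero_of_norm_lt_one hab hab
  have hlim : Tendsto (fun n => qPoch b (a * b) n * qPochInf a (a * b)) atTop
      (𝓝 (∑' k, thetaTerm a b k * (qPochInf (a * b) (a * b))⁻¹)) := by
    simp only [← (hasSum_thetaTerm_mul_qPochSelfInv hab _).tsum_eq]
    refine tendsto_tsum_of_dominated_convergence ((summable_thetaTerm hab).norm.mul_right C)
      (fun k => (tendsto_qPochSelfInv hab k).const_mul _) (Eventually.of_forall fun n k => ?_)
    rw [norm_mul]
    gcongr
    exact hC _
  have hsum := tendsto_nhds_unique hlim ((tendsto_qPoch b hab).mul_const _)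
  rw [tsum_mul_right, ← div_eq_mul_inv, div_eq_iff h0] at hsum
  rw [mul_comm (qPochInf a _), mul_comm, ← hsum]
  exact (summable_thetaTerm hab).hasSum

end JacobiTripleProduct

theorem eq_zero_of_le_add_mul {u c : ℕ → ℝ} (hu : ∀ n, 0 ≤ u n) (hc : ∀ n, 0 ≤ c n)
    (hc_sum : Summable c) (h : ∀ n, u n ≤ u (n + 1) + c n * u (n + 2))
    (hlim : Tendsto u atTop (𝓝 0)) (n : ℕ) : u n = 0 := by
  let P : ℕ → ℝ := fun n => ∏ k ∈ Finset.range n, (1 + c k)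
  let M : ℕ → ℝ := fun n => max (u n) (u (n + 1))
  have hP : ∀ n, 0 < P n := fun n => Finset.prod_pos fun k _ => by linarith [hc k]
  have hPM : Tendsto (fun n => P n * M n) atTop (𝓝 0) := by
    have hPlim := (multipliable_one_add_of_summable hc_sum.norm).hasProd.tendsto_prod_nat
    simpa only [P, M, max_self, mul_zero, Function.comp_apply] using
      hPlim.mul (hlim.max (hlim.comp (tendsto_add_atTop_nat 1)))
  have hmono : Monotone fun n => P n * M n := monotone_nat_of_le_succ fun n => by
    have hle : M n ≤ (1 + c n) * M (n + 1) := by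
      have h1 : u (n + 1) ≤ M (n + 1) := le_max_left _ _
      have h2 : u (n + 2) ≤ M (n + 1) := le_max_right _ _
      have h3 : 0 ≤ c n * M (n + 1) := mul_nonneg (hc n) ((hu _).trans h1)
      refine max_le ?_ (by linarith)
      linarith [h n, mul_le_mul_of_nonneg_left h2 (hc n)]
    calc P n * M n ≤ P n * ((1 + c n) * M (n + 1)) := mul_le_mul_of_nonneg_left hle (hP n).le
      _ = P (n + 1) * M (n + 1) := by rw [← mul_assoc]; simp only [P, Finset.prod_range_succ]
  have hM : M n ≤ 0 := nonpos_of_mul_nonpos_right (hmono.ge_of_tendsto hPM n) (hP n)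
  exact le_antisymm ((le_max_left _ _).trans hM) (hu n)

section RogersSelberg

/-- The factor `(-1)^r a^(kr) q^(r + (2k+1)r(r-1)/2) (a; q)_r / (q; q)_r` shared by the
Rogers–Selberg functions of order `k`. -/
noncomputable def selbergFactor (k : ℕ) (q a : ℂ) (r : ℕ) : ℂ :=
  qExpTerm (2 * k + 1) q (-(a ^ k * q)) r * qPoch a q r

/-- The general term of `rogersSelberg`. -/
noncomputable def rogersSelbergTerm (i l : ℕ) (q a : ℂ) (r : ℕ) : ℂ :=
  selbergFactor (i + l) q a r * (q ^ (l * r) * (1 - a ^ i * q ^ (2 * i * r)))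

/-- The Rogers–Selberg function of order `k` and index `i`, the `(a; q)_∞`-multiple of Andrews'
`J_{k,i}`. It is indexed by `i` and `l = k - i`. -/
noncomputable def rogersSelberg (i l : ℕ) (q a : ℂ) : ℂ :=
  ∑' r, rogersSelbergTerm i l q a r

variable {q a : ℂ}

theorem selbergFactor_succ_mul (hq : ‖q‖ < 1) (k : ℕ) (a : ℂ) (r : ℕ) :
    selbergFactor k q a (r + 1) * (1 - q ^ (r + 1)) =
      -(a ^ k * q ^ ((2 * k + 1) * r + 1) * (1 - a * q ^ r) * selbergFactor k q a r) := by
  rw [selbergFactor, selbergFactor, qPoch_succ, mul_right_comm, qExpTerm_succ_mul hq]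
  ring

theorem one_sub_mul_selbergFactor_mul (k : ℕ) (q a : ℂ) (r : ℕ) :
    (1 - a) * selbergFactor k q (a * q) r =
      q ^ (k * r) * (1 - a * q ^ r) * selbergFactor k q a r := by
  have hz : -((a * q) ^ k * q) = -(a ^ k * q) * q ^ k := by ring
  have hP : (1 - a) * qPoch (a * q) q r = qPoch a q r * (1 - a * q ^ r) := by
    rw [← qPoch_succ', qPoch_succ]
  rw [selbergFactor, selbergFactor, hz, qExpTerm_mul]
  linear_combination qExpTerm (2 * k + 1) q (-(a ^ k * q)) r * (q ^ k) ^ r * hP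

theorem exists_summable_norm_selbergFactor_le (hq : ‖q‖ < 1) (k : ℕ) :
    ∃ u : ℕ → ℝ, Summable u ∧ ∀ a : ℂ, ‖a‖ ≤ 1 → ∀ r, ‖selbergFactor k q a r‖ ≤ u r := by
  obtain ⟨C, hC⟩ := exists_forall_norm_qPoch_le hq 1
  have hs := (summable_qExpTerm (α := 2 * k + 1) (z := q) hq fun _ => hq).norm
  refine ⟨_, hs.mul_right C, fun a ha r => ?_⟩
  have hz : ‖-(a ^ k * q)‖ ≤ ‖q‖ := by
    rw [norm_neg, norm_mul, norm_pow]
    exact mul_le_of_le_one_left (norm_nonneg q) (pow_le_one₀ (norm_nonneg a) ha)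
  rw [selbergFactor, norm_mul]
  gcongr
  · exact norm_qExpTerm_le hz _ q r
  · exact hC a ha r

theorem norm_mul_pow_mul_one_sub_le {x : ℂ} (hq : ‖q‖ < 1) (hx : ‖x‖ ≤ 1) (c : ℂ) (m : ℕ) :
    ‖c * (q ^ m * (1 - x))‖ ≤ ‖c‖ * 2 := by
  rw [norm_mul, mul_comm (q ^ m)]
  gcongr
  exact (norm_mul_pow_le hq _ m).trans (norm_one_sub_le_two hx)

theorem exists_summable_norm_rogersSelbergTerm_le (hq : ‖q‖ < 1) (i l : ℕ) :
    ∃ u : ℕ → ℝ, Summable u ∧ ∀ a : ℂ, ‖a‖ ≤ 1 → ∀ r, ‖rogersSelbergTerm i l q a r‖ ≤ u r := by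
  obtain ⟨u, hu, hle⟩ := exists_summable_norm_selbergFactor_le hq (i + l)
  refine ⟨_, hu.mul_right 2, fun a ha r => ?_⟩
  have hx : ‖a ^ i * q ^ (2 * i * r)‖ ≤ 1 := by
    refine (norm_mul_pow_le hq _ _).trans ?_
    rw [norm_pow]
    exact pow_le_one₀ (norm_nonneg a) ha
  calc ‖rogersSelbergTerm i l q a r‖ ≤ ‖selbergFactor (i + l) q a r‖ * 2 :=
        norm_mul_pow_mul_one_sub_le hq hx _ _
    _ ≤ u r * 2 := by gcongr; exact hle a ha r

theorem hasSum_rogersSelberg (hq : ‖q‖ < 1) (ha : ‖a‖ ≤ 1) (i l : ℕ) :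
    HasSum (rogersSelbergTerm i l q a) (rogersSelberg i l q a) := by
  obtain ⟨u, hu, hle⟩ := exists_summable_norm_rogersSelbergTerm_le hq i l
  exact (Summable.of_norm_bounded hu (hle a ha)).hasSum

theorem continuousOn_rogersSelberg (hq : ‖q‖ < 1) (i l : ℕ) :
    ContinuousOn (rogersSelberg i l q) (Metric.closedBall 0 1) := by
  obtain ⟨u, hu, hle⟩ := exists_summable_norm_rogersSelbergTerm_le hq i l
  refine continuousOn_tsum (fun r => Continuous.continuousOn ?_) hu fun r a ha =>
    hle a (mem_closedBall_zero_iff.mp ha) r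
  unfold rogersSelbergTerm selbergFactor qExpTerm qPoch
  fun_prop

theorem rogersSelberg_zero_left (l : ℕ) (q a : ℂ) : rogersSelberg 0 l q a = 0 := by
  simp [rogersSelberg, rogersSelbergTerm]

theorem rogersSelberg_succ_zero (i l : ℕ) (q : ℂ) : rogersSelberg (i + 1) l q 0 = 1 := by
  rw [rogersSelberg, tsum_eq_single 0 fun r hr => ?_]
  · simp [rogersSelbergTerm, selbergFactor, qExpTerm_zero, qPoch_zero]
  · simp [rogersSelbergTerm, selbergFactor, qExpTerm, zero_pow hr, add_right_comm]

theorem tendsto_rogersSelberg (hq : ‖q‖ < 1) (ha : ‖a‖ ≤ 1) (i l : ℕ) :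
    Tendsto (fun n : ℕ => rogersSelberg (i + 1) l q (a * q ^ n)) atTop (𝓝 1) := by
  have h := (continuousOn_rogersSelberg hq (i + 1) l).continuousWithinAt
    (Metric.mem_closedBall_self zero_le_one)
  rw [ContinuousWithinAt, rogersSelberg_succ_zero] at h
  refine h.comp (tendsto_nhdsWithin_iff.mpr ⟨tendsto_mul_pow_nhds_zero hq a, ?_⟩)
  exact Eventually.of_forall fun n =>
    mem_closedBall_zero_iff.mpr ((norm_mul_pow_le hq a n).trans ha)

theorem rogersSelberg_sub (hq : ‖q‖ < 1) (ha : ‖a‖ ≤ 1) (j l : ℕ) :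
    rogersSelberg (j + 1) l q a - rogersSelberg j (l + 1) q a =
      a ^ j * (1 - a) * rogersSelberg (l + 1) j q (a * q) := by
  have haq : ‖a * q‖ ≤ 1 := by simpa only [pow_one] using (norm_mul_pow_le hq a 1).trans ha
  -- The two sides agree termwise only up to the telescoping difference `u (r + 1) - u r`.
  let u : ℕ → ℂ := fun r => selbergFactor (j + l + 1) q a r * (q ^ (l * r) * (1 - q ^ r))
  have hu : Summable u := by
    obtain ⟨v, hv, hle⟩ := exists_summable_norm_selbergFactor_le hq (j + l + 1)
    refine .of_norm_bounded (hv.mul_right 2) fun r => ?_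
    have hqr : ‖q ^ r‖ ≤ 1 := by
      rw [norm_pow]
      exact pow_le_one₀ (norm_nonneg q) hq.le
    refine (norm_mul_pow_mul_one_sub_le hq hqr _ _).trans ?_
    gcongr
    exact hle a ha r
  have hu_succ : HasSum (fun r => u (r + 1)) (∑' r, u r) := by
    simpa [u] using (hasSum_nat_add_iff' 1).mpr hu.hasSum
  have hsub := (hasSum_rogersSelberg hq ha (j + 1) l).sub (hasSum_rogersSelberg hq ha j (l + 1))
  have telescoped := (hsub.sub hu.hasSum).add hu_succ
  rw [sub_add_cancel] at telescoped
  refine telescoped.unique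
    (((hasSum_rogersSelberg hq haq (l + 1) j).mul_left (a ^ j * (1 - a))).congr_fun fun r => ?_)
  have hF := one_sub_mul_selbergFactor_mul (j + l + 1) q a r
  have hF_succ := selbergFactor_succ_mul hq (j + l + 1) a r
  simp only [rogersSelbergTerm, u, show j + 1 + l = j + l + 1 by ring,
    show j + (l + 1) = j + l + 1 by ring, show l + 1 + j = j + l + 1 by ring]
  linear_combination q ^ (l * (r + 1)) * hF_succ -
    a ^ j * q ^ (j * r) * (1 - (a * q) ^ (l + 1) * q ^ (2 * (l + 1) * r)) * hF

theorem rogersSelberg_self (hq : ‖q‖ < 1) (i l : ℕ) :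
    rogersSelberg (i + 1) l q q =
      qPochInf (q ^ (2 * (i + 1 + l) + 1)) (q ^ (2 * (i + 1 + l) + 1)) *
        (qPochInf (q ^ (i + 2 * l + 2)) (q ^ (2 * (i + 1 + l) + 1)) *
          qPochInf (q ^ (i + 1)) (q ^ (2 * (i + 1 + l) + 1))) := by
  have hQ : q ^ (i + 2 * l + 2) * q ^ (i + 1) = q ^ (2 * (i + 1 + l) + 1) := by ring
  have jacobi := hasSum_jacobi_triple_product
    (hQ.symm ▸ norm_pow_succ_lt_one hq (2 * (i + 1 + l)))
  rw [hQ] at jacobi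
  refine HasSum.unique (hasSum_rogersSelberg hq hq.le (i + 1) l)
    (jacobi.nat_add_neg_add_one.congr_fun fun r => ?_)
  have h0 := qPoch_ne_zero hq hq r
  have hneg : -((r : ℤ) + 1) = -(r + 1 : ℕ) := by push_cast; ring
  rw [rogersSelbergTerm, selbergFactor, qExpTerm, div_mul_cancel₀ _ h0, hneg,
    thetaTerm_natCast, thetaTerm_neg_natCast, succ_choose_two, hQ]
  ring

end RogersSelberg

section RogersRamanujan

variable {q a : ℂ}

theorem rogersSelberg_one_one (hq : ‖q‖ < 1) (ha : ‖a‖ ≤ 1) :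
    rogersSelberg 1 1 q a = (1 - a) * rogersSelberg 2 0 q (a * q) := by
  simpa only [zero_add, rogersSelberg_zero_left, sub_zero, pow_zero, one_mul] using
    rogersSelberg_sub hq ha 0 1

theorem rogersSelberg_two_zero (hq : ‖q‖ < 1) (ha : ‖a‖ ≤ 1) :
    rogersSelberg 2 0 q a = (1 - a) * rogersSelberg 2 0 q (a * q) +
      a * (1 - a) * ((1 - a * q) * rogersSelberg 2 0 q (a * q ^ 2)) := by
  have haq : ‖a * q‖ ≤ 1 := by simpa only [pow_one] using (norm_mul_pow_le hq a 1).trans ha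
  have h := rogersSelberg_sub hq ha 1 0
  rw [pow_one, zero_add, one_add_one_eq_two] at h
  rw [pow_two, ← mul_assoc a, ← rogersSelberg_one_one hq haq, ← rogersSelberg_one_one hq ha,
    ← h, add_sub_cancel]

theorem rogersSelberg_two_zero_div_qPochInf (hq : ‖q‖ < 1) (ha : ‖a‖ < 1) :
    rogersSelberg 2 0 q a / qPochInf a q =
      rogersSelberg 2 0 q (a * q) / qPochInf (a * q) q +
        a * (rogersSelberg 2 0 q (a * q ^ 2) / qPochInf (a * q ^ 2) q) := by
  have hpow (n : ℕ) : ‖a * q ^ n‖ < 1 := (norm_mul_pow_le hq a n).trans_lt ha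
  have h1 := one_sub_ne_zero_of_norm_lt_one ha
  have h2 := one_sub_ne_zero_of_norm_lt_one (hpow 1)
  have h3 := qPochInf_ne_zero_of_norm_lt_one hq (hpow 2)
  rw [rogersSelberg_two_zero hq ha.le, qPochInf_eq_one_sub_mul a hq,
    qPochInf_eq_one_sub_mul (a * q) hq, mul_assoc a q q, ← pow_two]
  rw [pow_one] at h2
  field_simp

theorem rogersSelberg_two_zero_eq (hq : ‖q‖ < 1) (ha : ‖a‖ < 1) :
    rogersSelberg 2 0 q a = qPochInf a q * qExpSeries 2 q a := by
  let d : ℕ → ℂ := fun n =>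
    rogersSelberg 2 0 q (a * q ^ n) / qPochInf (a * q ^ n) q - qExpSeries 2 q (a * q ^ n)
  have hd (n : ℕ) : d n = d (n + 1) + a * q ^ n * d (n + 2) := by
    have hR := rogersSelberg_two_zero_div_qPochInf hq ((norm_mul_pow_le hq a n).trans_lt ha)
    have hS := qExpSeries_sub (α := 2) (z := a * q ^ n) hq (absurd · two_ne_zero)
    simp only [mul_assoc a _ q, mul_assoc a _ (q ^ 2), ← pow_succ, ← pow_add] at hR hS
    simp only [d]
    linear_combination hR - hS
  have hlim : Tendsto d atTop (𝓝 0) := by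
    have h := ((tendsto_rogersSelberg hq ha.le 1 0).div (tendsto_qPochInf_mul_pow hq ha)
      one_ne_zero).sub (tendsto_qExpSeries (α := 2) (z := a) hq (absurd · two_ne_zero))
    rwa [div_one, sub_self] at h
  have hc : Summable fun n => ‖a * q ^ n‖ := by
    simpa only [norm_mul, norm_pow] using
      (summable_geometric_of_lt_one (norm_nonneg q) hq).mul_left ‖a‖
  have h0 := eq_zero_of_le_add_mul (fun n => norm_nonneg (d n)) (fun n => norm_nonneg _) hc
    (fun n => by rw [← norm_mul, hd n]; exact norm_add_le _ _) (by simpa using hlim.norm) 0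
  rw [norm_eq_zero, sub_eq_zero, pow_zero, mul_one,
    div_eq_iff (qPochInf_ne_zero_of_norm_lt_one hq ha)] at h0
  rw [h0, mul_comm]

theorem qPochInf_self_eq_prod_five (hq : ‖q‖ < 1) :
    qPochInf q q = qPochInf q (q ^ 5) * qPochInf (q ^ 2) (q ^ 5) * qPochInf (q ^ 3) (q ^ 5) *
      qPochInf (q ^ 4) (q ^ 5) * qPochInf (q ^ 5) (q ^ 5) := by
  rw [qPochInf_eq_prod q hq 4]
  simp only [Finset.prod_range_succ, Finset.prod_range_zero, one_mul, ← pow_succ', zero_add,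
    pow_one, Nat.reduceAdd]

theorem qPochInf_pow_succ_ne_zero (hq : ‖q‖ < 1) (m n : ℕ) :
    qPochInf (q ^ (m + 1)) (q ^ (n + 1)) ≠ 0 :=
  qPochInf_ne_zero_of_norm_lt_one (norm_pow_succ_lt_one hq n) (norm_pow_succ_lt_one hq m)

theorem two_mul_choose_two_add (n : ℕ) : 2 * n.choose 2 + n = n ^ 2 := by
  induction n with
  | zero => rfl
  | succ n ih =>
    rw [succ_choose_two]
    linarith

theorem hasSum_rogersRamanujan_one (hq : ‖q‖ < 1) :
    HasSum (fun n : ℕ => q ^ n ^ 2 / qPoch q q n)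
      (qPochInf q (q ^ 5) * qPochInf (q ^ 4) (q ^ 5))⁻¹ := by
  have product := rogersSelberg_self hq 1 0
  norm_num only at product
  rw [rogersSelberg_two_zero_eq hq hq, qPochInf_self_eq_prod_five hq] at product
  have hval : qExpSeries 2 q q * (qPochInf q (q ^ 5) * qPochInf (q ^ 4) (q ^ 5)) = 1 := by
    have h2 : qPochInf (q ^ 2) (q ^ 5) ≠ 0 := qPochInf_pow_succ_ne_zero hq 1 4
    have h3 : qPochInf (q ^ 3) (q ^ 5) ≠ 0 := qPochInf_pow_succ_ne_zero hq 2 4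
    have h5 : qPochInf (q ^ 5) (q ^ 5) ≠ 0 := qPochInf_pow_succ_ne_zero hq 4 4
    refine mul_left_cancel₀ (mul_ne_zero h5 (mul_ne_zero h3 h2)) ?_
    linear_combination product
  rw [← eq_inv_of_mul_eq_one_left hval]
  refine (hasSum_qExpSeries hq fun _ => hq).congr_fun fun n => ?_
  rw [qExpTerm, ← pow_add, ← two_mul_choose_two_add, add_comm]

theorem hasSum_rogersRamanujan_two (hq : ‖q‖ < 1) :
    HasSum (fun n : ℕ => q ^ (n ^ 2 + n) / qPoch q q n)
      (qPochInf (q ^ 2) (q ^ 5) * qPochInf (q ^ 3) (q ^ 5))⁻¹ := by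
  have hq2 := norm_pow_succ_lt_one hq 1
  have product := rogersSelberg_self hq 0 1
  norm_num only [pow_one] at product
  rw [rogersSelberg_one_one hq hq.le, ← pow_two, rogersSelberg_two_zero_eq hq hq2, ← mul_assoc,
    pow_two, ← qPochInf_eq_one_sub_mul q hq, ← pow_two, qPochInf_self_eq_prod_five hq] at product
  have hval : qExpSeries 2 q (q ^ 2) *
      (qPochInf (q ^ 2) (q ^ 5) * qPochInf (q ^ 3) (q ^ 5)) = 1 := by
    have h1 : qPochInf q (q ^ 5) ≠ 0 := by simpa using qPochInf_pow_succ_ne_zero hq 0 4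
    have h4 : qPochInf (q ^ 4) (q ^ 5) ≠ 0 := qPochInf_pow_succ_ne_zero hq 3 4
    have h5 : qPochInf (q ^ 5) (q ^ 5) ≠ 0 := qPochInf_pow_succ_ne_zero hq 4 4
    refine mul_left_cancel₀ (mul_ne_zero h5 (mul_ne_zero h4 h1)) ?_
    linear_combination product
  rw [← eq_inv_of_mul_eq_one_left hval]
  refine (hasSum_qExpSeries hq fun _ => hq2).congr_fun fun n => ?_
  rw [qExpTerm, ← pow_mul, ← pow_add, ← two_mul_choose_two_add]
  ring

end RogersRamanujan

theorem hasSum_two_mul_add {𝕜 : Type*} [NormedField 𝕜] [CharZero 𝕜] {ε : ℕ} (hε : ε ≤ 1)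
    {f : ℕ → 𝕜} {A B : 𝕜} (hA : HasSum f A) (hB : HasSum (fun n => (-1) ^ n * f n) B) :
    HasSum (fun m => f (2 * m + ε)) ((A + (-1) ^ ε * B) / 2) := by
  have hinj : Function.Injective fun m => 2 * m + ε := fun m n h => by
    simpa only [Nat.add_right_cancel_iff, Nat.mul_right_inj two_ne_zero] using h
  have h := (hA.add (hB.mul_left ((-1) ^ ε))).div_const 2
  refine ((hinj.hasSum_iff fun n hn => ?_).mpr h).congr_fun fun m => ?_
  · have hodd : Odd (ε + n) := by
      rw [← Nat.not_even_iff_odd]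
      rintro ⟨m, hm⟩
      exact hn ⟨m - ε, by simp only; omega⟩
    rw [← mul_assoc, ← pow_add, hodd.neg_one_pow]
    ring
  · have heven : Even (ε + (2 * m + ε)) := ⟨m + ε, by ring⟩
    rw [Function.comp_apply, ← mul_assoc, ← pow_add, heven.neg_one_pow]
    ring

theorem hasSum_of_tsum_eq_mul_tsum {𝕜 ι κ μ : Type*} [NormedField 𝕜] [CompleteSpace 𝕜]
    {f : ι × κ → 𝕜} {g : μ × κ → 𝕜} {c : 𝕜} (hf : Summable f) (hg : Summable g)
    (h : ∀ j, ∑' i, f (i, j) = c * ∑' m, g (m, j)) : HasSum f (c * ∑' m, ∑' j, g (m, j)) := by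
  refine hf.hasSum_iff.mpr ?_
  rw [hf.tsum_prod, ← Summable.tsum_comm (f := fun i j => f (i, j)) hf, tsum_congr h,
    tsum_mul_left, Summable.tsum_comm (f := fun m j => g (m, j)) hg]

section DoubleSeries

variable {q w : ℂ} {ε : ℕ}

theorem hasSum_qExpTerm_two_mul_add (hq : ‖q‖ < 1) (hε : ε ≤ 1) {α : ℕ} {z : ℂ}
    (hz : α = 0 → ‖z‖ < 1) :
    HasSum (fun m => qExpTerm α q z (2 * m + ε))
      ((qExpSeries α q z + (-1) ^ ε * qExpSeries α q (-z)) / 2) := by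
  refine hasSum_two_mul_add hε (hasSum_qExpSeries hq hz) ?_
  refine (hasSum_qExpSeries hq fun h => (norm_neg z).trans_lt (hz h)).congr_fun fun n => ?_
  rw [← mul_neg_one z, qExpTerm_mul, mul_comm]

theorem tsum_qExpTerm_zero_two_mul_add {z : ℂ} (hq : ‖q‖ < 1) (hε : ε ≤ 1) (hz : ‖z‖ < 1) :
    ∑' i, qExpTerm 0 q z (2 * i + ε) =
      (qPochInf (z ^ 2) (q ^ 2))⁻¹ * ∑' m, qExpTerm 1 q z (2 * m + ε) := by
  have hz' : ‖-z‖ < 1 := (norm_neg z).trans_lt hz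
  have h1 := qPochInf_ne_zero_of_norm_lt_one hq hz
  have h2 := qPochInf_ne_zero_of_norm_lt_one hq hz'
  rw [(hasSum_qExpTerm_two_mul_add hq hε fun _ => hz).tsum_eq,
    (hasSum_qExpTerm_two_mul_add hq hε (absurd · one_ne_zero)).tsum_eq, qExpSeries_zero hq hz,
    qExpSeries_zero hq hz', qExpSeries_one hq, qExpSeries_one hq, neg_neg, ← qPochInf_mul_neg z hq]
  field_simp

theorem tsum_pow_div_qPoch_two_mul_add {y : ℂ} (hq : ‖q‖ < 1) (hε : ε ≤ 1) (hy : ‖y‖ < 1) :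
    ∑' i, y ^ i / qPoch q q (2 * i + ε) =
      (qPochInf y (q ^ 2))⁻¹ *
        ∑' m, y ^ m * (q ^ (2 * m + ε).choose 2 / qPoch q q (2 * m + ε)) := by
  rcases eq_or_ne y 0 with rfl | hy0
  · rw [tsum_eq_single 0 fun i hi => by rw [zero_pow hi, zero_div],
      tsum_eq_single 0 fun i hi => by rw [zero_pow hi, zero_mul]]
    simp [qPochInf, Nat.choose_eq_zero_of_lt (Nat.lt_succ_of_le hε)]
  · obtain ⟨z, rfl⟩ := IsAlgClosed.exists_pow_nat_eq y two_pos
    have hz : ‖z‖ < 1 := by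
      rwa [norm_pow, pow_lt_one_iff_of_nonneg (norm_nonneg z) two_ne_zero] at hy
    have hz0 : z ^ ε ≠ 0 := pow_ne_zero _ (ne_zero_pow two_ne_zero hy0)
    have hterm (α m : ℕ) : qExpTerm α q z (2 * m + ε) =
        z ^ ε * ((z ^ 2) ^ m * (q ^ (α * (2 * m + ε).choose 2) / qPoch q q (2 * m + ε))) := by
      rw [qExpTerm]
      ring
    have h := tsum_qExpTerm_zero_two_mul_add hq hε hz
    simp only [hterm, tsum_mul_left, zero_mul, one_mul, pow_zero, mul_one_div,
      mul_left_comm _ (z ^ ε)] at h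
    exact mul_left_cancel₀ hz0 h

theorem qPoch_self_two_mul_add (q : ℂ) (hε : ε ≤ 1) (m : ℕ) :
    qPoch q q (2 * m + ε) = qPoch q (q ^ 2) (m + ε) * qPoch (q ^ 2) (q ^ 2) m := by
  have even : qPoch q q (2 * m) = qPoch q (q ^ 2) m * qPoch (q ^ 2) (q ^ 2) m := by
    rw [qPoch_mul_index, Finset.prod_range_succ, Finset.prod_range_one, pow_zero, mul_one, pow_one,
      ← pow_two]
  interval_cases ε
  · exact even
  · rw [qPoch_succ, qPoch_succ, even]
    ring

theorem qPoch_self_two_mul_add_mul_qPochInf (hq : ‖q‖ < 1) (hε : ε ≤ 1) (m : ℕ) :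
    qPoch q q (2 * m + ε) * qPochInf (q ^ (2 * (m + ε) + 1)) (q ^ 2) =
      qPochInf q (q ^ 2) * qPoch (q ^ 2) (q ^ 2) m := by
  rw [qPoch_self_two_mul_add q hε, mul_right_comm, pow_succ' q (2 * _), pow_mul,
    qPoch_mul_qPochInf q (norm_pow_succ_lt_one hq 1)]

theorem summable_pow_mul_pow_mul (hq : ‖q‖ < 1) (hw : ‖w‖ < 1) {u v : ℕ → ℂ} {C D : ℝ}
    (hu : ∀ i, ‖u i‖ ≤ C) (hv : ∀ j, ‖v j‖ ≤ D) :
    Summable fun p : ℕ × ℕ => q ^ (2 * p.1 * p.2 + p.1) * w ^ p.2 * (u p.1 * v p.2) := by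
  have hs := ((summable_geometric_of_lt_one (norm_nonneg q) hq).mul_of_nonneg
    (summable_geometric_of_lt_one (norm_nonneg w) hw) (fun _ => by positivity)
    (fun _ => by positivity)).mul_right (C * D)
  refine .of_norm_bounded hs fun p => ?_
  have hC : 0 ≤ C := (norm_nonneg _).trans (hu 0)
  have hpow : ‖q‖ ^ (2 * p.1 * p.2 + p.1) ≤ ‖q‖ ^ p.1 :=
    pow_le_pow_of_le_one (norm_nonneg q) hq.le (Nat.le_add_left _ _)
  rw [norm_mul, norm_mul, norm_mul, norm_pow, norm_pow]
  gcongr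
  · exact hu p.1
  · exact hv p.2

theorem tsum_pow_mul_pow_div_qPoch (hq : ‖q‖ < 1) (hε : ε ≤ 1) (w : ℂ) (j : ℕ) :
    ∑' i, q ^ (2 * i * j + i) * w ^ j * ((qPoch q q (2 * i + ε))⁻¹ * (qPoch q q (2 * j))⁻¹) =
      (qPochInf q (q ^ 2))⁻¹ * ∑' m, q ^ (2 * m * j + m) * w ^ j *
        (q ^ (2 * m + ε).choose 2 / qPoch q q (2 * m + ε) * (qPoch (q ^ 2) (q ^ 2) j)⁻¹) := by
  have hprod := congrArg (·⁻¹) (qPoch_self_two_mul_add_mul_qPochInf hq zero_le_one j)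
  simp only [mul_inv, add_zero] at hprod
  calc _ = w ^ j * (qPoch q q (2 * j))⁻¹ *
        ∑' i, (q ^ (2 * j + 1)) ^ i / qPoch q q (2 * i + ε) := by
        rw [← tsum_mul_left]
        exact tsum_congr fun i => by ring
    _ = w ^ j * ((qPochInf q (q ^ 2))⁻¹ * (qPoch (q ^ 2) (q ^ 2) j)⁻¹) *
        ∑' m, (q ^ (2 * j + 1)) ^ m * (q ^ (2 * m + ε).choose 2 / qPoch q q (2 * m + ε)) := by
        rw [tsum_pow_div_qPoch_two_mul_add hq hε (norm_pow_succ_lt_one hq (2 * j)), ← hprod]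
        ring
    _ = _ := by
        rw [mul_left_comm, mul_assoc, ← tsum_mul_left]
        congr 1
        exact tsum_congr fun m => by ring

theorem tsum_pow_mul_pow_mul_qPoch_inv (hq : ‖q‖ < 1) (hw : ‖w‖ < 1) (c : ℂ) (m : ℕ) :
    ∑' j, q ^ (2 * m * j + m) * w ^ j * (c * (qPoch (q ^ 2) (q ^ 2) j)⁻¹) =
      q ^ m * c * (qPochInf (w * q ^ (2 * m)) (q ^ 2))⁻¹ := by
  rw [← qExpSeries_zero (norm_pow_succ_lt_one hq 1) ((norm_mul_pow_le hq w _).trans_lt hw),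
    qExpSeries, ← tsum_mul_left]
  refine tsum_congr fun j => ?_
  rw [qExpTerm]
  ring

theorem hasSum_double_qPoch (hq : ‖q‖ < 1) (hε : ε ≤ 1) (hw : ‖w‖ < 1) :
    HasSum (fun p : ℕ × ℕ => q ^ (2 * p.1 * p.2 + p.1) * w ^ p.2 *
        ((qPoch q q (2 * p.1 + ε))⁻¹ * (qPoch q q (2 * p.2))⁻¹))
      ((qPochInf q (q ^ 2))⁻¹ * ∑' m, q ^ m * (q ^ (2 * m + ε).choose 2 / qPoch q q (2 * m + ε)) *
        (qPochInf (w * q ^ (2 * m)) (q ^ 2))⁻¹) := by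
  have hq2 := norm_pow_succ_lt_one hq 1
  obtain ⟨C, hC⟩ := exists_norm_qPoch_inv_le hq hq
  obtain ⟨D, hD⟩ := exists_norm_qPoch_inv_le hq2 hq2
  have hcoeff (m : ℕ) : ‖q ^ (2 * m + ε).choose 2 / qPoch q q (2 * m + ε)‖ ≤ C := by
    rw [div_eq_inv_mul]
    exact (norm_mul_pow_le hq _ _).trans (hC _)
  have hf := summable_pow_mul_pow_mul hq hw (fun i => hC (2 * i + ε)) fun j => hC (2 * j)
  have hg := summable_pow_mul_pow_mul hq hw hcoeff hD
  have h := hasSum_of_tsum_eq_mul_tsum hf hg (tsum_pow_mul_pow_div_qPoch hq hε w)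
  simpa only [tsum_pow_mul_pow_mul_qPoch_inv hq hw] using h

theorem add_choose_two_two_mul_add (hε : ε ≤ 1) (m : ℕ) :
    m + (2 * m + ε).choose 2 = 2 * (m ^ 2 + ε * m) := by
  have h := two_mul_choose_two_add (2 * m + ε)
  have hsq : ε ^ 2 = ε := by interval_cases ε <;> rfl
  linarith

theorem hasSum_double_qPoch_odd_pow (hq : ‖q‖ < 1) (hε : ε ≤ 1) :
    HasSum (fun p : ℕ × ℕ => q ^ (2 * p.1 * p.2 + p.1 + (2 * ε + 1) * p.2) /
        (qPoch q q (2 * p.1 + ε) * qPoch q q (2 * p.2)))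
      ((qPochInf q (q ^ 2) ^ 2)⁻¹ *
        ∑' m, (q ^ 2) ^ (m ^ 2 + ε * m) / qPoch (q ^ 2) (q ^ 2) m) := by
  have hterm (m : ℕ) : q ^ m * (q ^ (2 * m + ε).choose 2 / qPoch q q (2 * m + ε)) *
      (qPochInf (q ^ (2 * ε + 1) * q ^ (2 * m)) (q ^ 2))⁻¹ =
      (qPochInf q (q ^ 2))⁻¹ * ((q ^ 2) ^ (m ^ 2 + ε * m) / qPoch (q ^ 2) (q ^ 2) m) := by
    have hpow : q ^ (2 * ε + 1) * q ^ (2 * m) = q ^ (2 * (m + ε) + 1) := by ring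
    rw [hpow, ← mul_div_assoc, ← pow_add, add_choose_two_two_mul_add hε, ← div_eq_mul_inv, div_div,
      qPoch_self_two_mul_add_mul_qPochInf hq hε, pow_mul, div_mul_eq_div_div, div_eq_inv_mul]
    ring
  have h := hasSum_double_qPoch hq hε (norm_pow_succ_lt_one hq (2 * ε))
  rw [tsum_congr hterm, tsum_mul_left, ← mul_assoc, ← mul_inv, ← pow_two] at h
  refine h.congr_fun fun p => ?_
  rw [pow_add, pow_mul _ (2 * ε + 1), div_eq_mul_inv, mul_inv]

end DoubleSeries

theorem theorem1p1 (q : ℂ) (hq : ‖q‖ < 1) :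
    HasSum
      (fun p : ℕ × ℕ =>
        q ^ (2 * p.1 * p.2 + p.1 + p.2) / (qPoch q q (2 * p.1) * qPoch q q (2 * p.2)))
      (1 / (qPochInf q (q ^ 2) ^ 2 *
        (qPochInf (q ^ 2) (q ^ 10) * qPochInf (q ^ 8) (q ^ 10)))) ∧
    HasSum
      (fun p : ℕ × ℕ =>
        q ^ (2 * p.1 * p.2 + p.1 + 3 * p.2) / (qPoch q q (2 * p.1 + 1) * qPoch q q (2 * p.2)))
      (1 / (qPochInf q (q ^ 2) ^ 2 *
        (qPochInf (q ^ 4) (q ^ 10) * qPochInf (q ^ 6) (q ^ 10)))) := by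
  have hq2 : ‖q ^ 2‖ < 1 := norm_pow_succ_lt_one hq 1
  have first := hasSum_double_qPoch_odd_pow hq zero_le_one
  have second := hasSum_double_qPoch_odd_pow hq le_rfl
  simp only [zero_mul, mul_zero, zero_add, add_zero, one_mul,
    (hasSum_rogersRamanujan_one hq2).tsum_eq] at first
  simp only [one_mul, (hasSum_rogersRamanujan_two hq2).tsum_eq] at second
  simp only [← mul_inv, ← pow_mul] at first second
  simp only [one_div]
  exact ⟨first, second⟩
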